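/- Let $n\ge 0$ be an integer. Let $C(n)$ be the set of all compact convex bodies in $\mathbb{R}^n$ (compact convex sets with nonempty interior) that are symmetric about $0$, equipped with the Hausdorff metric $\rho_H$ induced by the Euclidean norm. For $V\in C(n)$, the Löwner ellipsoid of $V$ is the ellipsoid of minimal volume among the ellipsoids $T(B^n)$, $T\in GL(n)$, that contain $V$, where $B^n$ is the closed Euclidean unit ball. Let $L(n)\subset C(n)$ be the set of all bodies whose Löwner ellipsoid is $B^n$, and let $L_E(n)=L(n)\setminus\{B^n\}$. The orthogonal group $O(n)$ acts on $L_E(n)$ by $g\cdot V=g(V)$. **Theorem 3.1.** For every $\delta>0$ there exist continuous $O(n)$-equivariant maps $f_1,f_2:L_E(n)\to L_E(n)$ such that $$\sup_{V\in L_E(n)}\rho_H(f_i(V),V)<\delta\quad(i=1,2)\qquad\text{and}\qquad f_1(L_E(n))\cap f_2(L_E(n))=\emptyset .$$ (If $L_E(n)$ is empty, which happens for $n\le 1$, the supremum is read as $0$.) -/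

import Mathlib

open Set MeasureTheory
open scoped ENNReal

namespace BanachMazur

/-- `ℝⁿ` with the Euclidean norm. -/
abbrev E (n : ℕ) : Type := EuclideanSpace ℝ (Fin n)

/-- The orthogonal group `O(n)`: the group of linear isometries of `ℝⁿ`. -/
abbrev O (n : ℕ) : Type := E n ≃ₗᵢ[ℝ] E n

/-- The closed Euclidean unit ball `Bⁿ`, as a compact convex set. -/
def unitBall (n : ℕ) : ConvexBody (E n) where
  carrier := Metric.closedBall 0 1
  convex' := convex_closedBall 0 1
  isCompact' := isCompact_closedBall 0 1
  nonempty' := ⟨0, Metric.mem_closedBall_self zero_le_one⟩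

/-- `C(n)`: the compact convex bodies in `ℝⁿ` (that is, with nonempty interior) that are symmetric
about `0`. Mathlib's `ConvexBody` is a nonempty compact convex set, possibly without interior
points; its metric is the Hausdorff metric. -/
def C (n : ℕ) : Set (ConvexBody (E n)) :=
  {V | (interior (V : Set (E n))).Nonempty ∧ ∀ x ∈ V, -x ∈ V}

/-- The ellipsoids centred at `0`: the images of the unit ball under `GL(n)`. -/
def ellipsoids (n : ℕ) : Set (Set (E n)) :=
  {S | ∃ T : E n ≃ₗ[ℝ] E n, S = T '' Metric.closedBall (0 : E n) 1}

/-- `S` is the Löwner ellipsoid of `V`: among the ellipsoids (centred at `0`) that contain `V` it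
has minimal volume. -/
def IsLoewnerEllipsoid {n : ℕ} (S : Set (E n)) (V : ConvexBody (E n)) : Prop :=
  S ∈ ellipsoids n ∧ (V : Set (E n)) ⊆ S ∧
    ∀ S' ∈ ellipsoids n, (V : Set (E n)) ⊆ S' → volume S ≤ volume S'

/-- `L(n)`: the bodies in `C(n)` whose Löwner ellipsoid is the unit ball. -/
def L (n : ℕ) : Set (ConvexBody (E n)) :=
  {V | V ∈ C n ∧ IsLoewnerEllipsoid (unitBall n : Set (E n)) V}

/-- `L_E(n) = L(n) \ {Bⁿ}`, a metric space with the Hausdorff metric. -/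
def LE (n : ℕ) : Set (ConvexBody (E n)) := L n \ {unitBall n}

/-- `O(n)` acts on compact convex sets by taking images. -/
instance {n : ℕ} : MulAction (O n) (ConvexBody (E n)) where
  smul g V :=
    { carrier := g '' (V : Set (E n))
      convex' := V.convex.linear_image g.toLinearEquiv.toLinearMap
      isCompact' := V.isCompact.image g.continuous
      nonempty' := V.nonempty.image g }
  one_smul V := ConvexBody.ext (Set.image_id (V : Set (E n)))
  mul_smul g h V := ConvexBody.ext (Set.image_comp g h (V : Set (E n)))

theorem coe_smul {n : ℕ} (g : O n) (V : ConvexBody (E n)) :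
    ((g • V : ConvexBody (E n)) : Set (E n)) = g '' (V : Set (E n)) := rfl

theorem smul_unitBall {n : ℕ} (g : O n) : g • unitBall n = unitBall n := by
  apply ConvexBody.ext
  rw [coe_smul]
  change g '' Metric.closedBall 0 1 = Metric.closedBall 0 1
  rw [LinearIsometryEquiv.image_closedBall, map_zero]

theorem preimage_mem_ellipsoids {n : ℕ} (g : O n) {S : Set (E n)} (hS : S ∈ ellipsoids n) :
    g ⁻¹' S ∈ ellipsoids n := by
  obtain ⟨T, rfl⟩ := hS
  refine ⟨T.trans g.symm.toLinearEquiv, ?_⟩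
  ext x
  constructor
  · rintro ⟨z, hz, hzx⟩
    exact ⟨z, hz, by simp [hzx]⟩
  · rintro ⟨z, hz, rfl⟩
    exact ⟨z, hz, by simp⟩

theorem smul_mem_L {n : ℕ} (g : O n) {V : ConvexBody (E n)} (hV : V ∈ L n) : g • V ∈ L n := by
  obtain ⟨⟨hint, hsymm⟩, hball, hsub, hmin⟩ := hV
  refine ⟨⟨?_, ?_⟩, hball, ?_, ?_⟩
  · rw [coe_smul, ← LinearIsometryEquiv.coe_toHomeomorph, ← Homeomorph.image_interior]
    exact hint.image _
  · rintro _ ⟨x, hx, rfl⟩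
    exact ⟨-x, hsymm x hx, map_neg g x⟩
  · rw [← smul_unitBall g, coe_smul, coe_smul]
    exact Set.image_mono hsub
  · intro S' hS' hVS'
    rw [coe_smul, Set.image_subset_iff] at hVS'
    refine (hmin _ (preimage_mem_ellipsoids g hS') hVS').trans_eq ?_
    exact g.measurePreserving.measure_preimage_equiv (f := g.toMeasurableEquiv) S'

theorem smul_mem_LE {n : ℕ} (g : O n) {V : ConvexBody (E n)} (hV : V ∈ LE n) : g • V ∈ LE n := by
  refine ⟨smul_mem_L g hV.1, fun h => hV.2 ?_⟩
  have h' : g • V = g • unitBall n := by rw [smul_unitBall]; exact h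
  exact MulAction.injective g h'

/-- `O(n)` acts on `L_E(n)` by taking images. -/
instance {n : ℕ} : MulAction (O n) (LE n) where
  smul g V := ⟨g • (V : ConvexBody (E n)), smul_mem_LE g V.2⟩
  one_smul V := Subtype.ext (one_smul (O n) (V : ConvexBody (E n)))
  mul_smul g h V := Subtype.ext (mul_smul g h (V : ConvexBody (E n)))

/-- The uniform distance `sup_x d(f x, g x)` between two maps. -/
noncomputable def uniformDist {X Y : Type*} [PseudoEMetricSpace Y] (f g : X → Y) : ℝ≥0∞ :=
  ⨆ x, edist (f x) (g x)

end BanachMazur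

/-! The images are kept apart by smoothness: one map makes every boundary smooth, and the other
creates corners on every body.

The first map is `s V + (1 - s) Bⁿ`, a union of balls of radius `1 - s`, so its norm has a tangent
hyperplane at each boundary point (`exists_tangent`). The second takes the unit ball of the average
of `max (‖x‖, aₖ p(x))`, where `p` is the norm of `V` and the `aₖ` are dense in `[s, 1]`. Both
constructions only enlarge `V` inside `Bⁿ`, which keeps the Löwner ellipsoid (`mem_LE_of_subset`),
and both tend to the identity uniformly as `s → 1`.

Suppose the second body were smooth. At a point with `‖x‖ = aₖ p(x)` the `k`-th maximum then has no
kink, so the tangent functional of the norm at `x` is bounded by `aₖ p` (`inner_le_of_level`). Hence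
`ρ = ‖x‖ / p(x)` exceeds a level value by at most a quadratic error. Density of the levels extends
this to all increments of `max s ρ` along a segment, which is therefore constant in the sense of
`eq_of_sub_le_sq`: its end values agree. But `ρ = 1` at a contact point of `V` with the sphere
(`exists_contact`), and `ρ < 1` somewhere because `V ≠ Bⁿ`. -/

namespace BanachMazur

/-! ### Functions with quadratically small increments. -/

section Rigidity

/-- A function whose increments on `[0, 1]` are bounded by the squares of the distances takes the
same value at the endpoints. -/
theorem eq_of_sub_le_sq {ψ : ℝ → ℝ} {c : ℝ}
    (h : ∀ a ∈ Icc (0 : ℝ) 1, ∀ b ∈ Icc (0 : ℝ) 1, ψ a - ψ b ≤ c * (a - b) ^ 2) :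
    ψ 0 = ψ 1 := by
  have hdist : ∀ a ∈ Icc (0 : ℝ) 1, ∀ b ∈ Icc (0 : ℝ) 1, |ψ a - ψ b| ≤ c * (a - b) ^ 2 := by
    intro a ha b hb
    rw [abs_le]
    constructor
    · have := h b hb a ha
      nlinarith
    · exact h a ha b hb
  -- Cut `[0, 1]` into `N + 1` equal pieces: each contributes at most `c / (N + 1)²`.
  have hN : ∀ N : ℕ, |ψ 0 - ψ 1| ≤ c * (1 / ((N : ℝ) + 1)) := by
    intro N
    have hN0 : (0 : ℝ) < (N : ℝ) + 1 := by positivity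
    have h1 := dist_le_range_sum_dist (fun i : ℕ => ψ (i / ((N : ℝ) + 1))) (N + 1)
    have h2 : ∑ i ∈ Finset.range (N + 1), dist (ψ ((i : ℕ) / ((N : ℝ) + 1)))
        (ψ (((i + 1 : ℕ) : ℝ) / ((N : ℝ) + 1)))
        ≤ ∑ i ∈ Finset.range (N + 1), c * (1 / ((N : ℝ) + 1)) ^ 2 := by
      refine Finset.sum_le_sum fun i hi => ?_
      have hi' : (i : ℝ) + 1 ≤ (N : ℝ) + 1 := by
        have := Finset.mem_range.1 hi
        exact_mod_cast this
      have h3 := hdist (i / ((N : ℝ) + 1)) ⟨by positivity, by rw [div_le_one hN0]; linarith⟩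
        (((i + 1 : ℕ) : ℝ) / ((N : ℝ) + 1))
        ⟨by positivity, by rw [div_le_one hN0]; push_cast; exact hi'⟩
      rw [Real.dist_eq]
      refine h3.trans_eq ?_
      push_cast
      ring
    have h3 := h1.trans h2
    rw [Finset.sum_const, Finset.card_range, Real.dist_eq, nsmul_eq_mul] at h3
    have h4 : (((N + 1 : ℕ) : ℝ) / ((N : ℝ) + 1)) = 1 := by push_cast; exact div_self hN0.ne'
    rw [h4] at h3
    simp only [Nat.cast_zero, zero_div] at h3
    refine h3.trans_eq ?_
    push_cast
    field_simp
  have hlim : Filter.Tendsto (fun N : ℕ => c * (1 / ((N : ℝ) + 1))) Filter.atTop (nhds (c * 0)) :=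
    tendsto_one_div_add_atTop_nhds_zero_nat.const_mul c
  have h0 : |ψ 0 - ψ 1| ≤ c * 0 := ge_of_tendsto' hlim hN
  rw [mul_zero] at h0
  exact sub_eq_zero.1 (abs_eq_zero.1 (le_antisymm h0 (abs_nonneg _)))

end Rigidity

/-! ### Smoothness of unions of balls of fixed radius. -/

section Smooth

variable {F : Type*} [NormedAddCommGroup F] [InnerProductSpace ℝ F]

/-- If a ball of radius `t` inside the unit ball of `q` touches its boundary at `x`, then `q` grows
at most quadratically at `x` in the directions pointing away from the normal. -/
theorem seminorm_add_smul_le {q : Seminorm ℝ F} {t : ℝ} (ht : 0 < t) {c x y : F}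
    (hc : ∀ w, ‖w - c‖ ≤ t → q w ≤ 1) (hx : ‖x - c‖ ≤ t) (hy : inner ℝ (x - c) y ≤ 0)
    {ε : ℝ} (hε : 0 ≤ ε) (hεy : ε * ‖y‖ ≤ t) :
    q (x + ε • y) ≤ 1 + (‖y‖ ^ 2 / t ^ 2 * q (x - c)) * ε ^ 2 := by
  set z := x - c with hz
  -- Pulling `x + ε y` back by `μ z` returns it to the ball, since `(1 - μ)² t² + μ t² ≤ t²`; the
  -- pull costs only `O(ε²)`.
  set μ := ε ^ 2 * ‖y‖ ^ 2 / t ^ 2 with hμ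
  have hμ0 : 0 ≤ μ := by positivity
  have hμ1 : μ ≤ 1 := by
    rw [hμ, div_le_one (by positivity), ← mul_pow]
    exact pow_le_pow_left₀ (by positivity) hεy 2
  have hμt : ε ^ 2 * ‖y‖ ^ 2 = μ * t ^ 2 := by rw [hμ]; field_simp
  have h1 : ‖(x + ε • y - μ • z) - c‖ ≤ t := by
    have e : (x + ε • y - μ • z) - c = (1 - μ) • z + ε • y := by rw [hz]; module
    rw [e]
    refine le_of_sq_le_sq ?_ ht.le
    rw [norm_add_sq_real, norm_smul, norm_smul, inner_smul_left, inner_smul_right,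
      Real.norm_eq_abs, Real.norm_eq_abs, mul_pow, mul_pow, sq_abs, sq_abs, hμt]
    have h2 : (1 - μ) ^ 2 * ‖z‖ ^ 2 ≤ (1 - μ) ^ 2 * t ^ 2 := by gcongr
    have h3 : (starRingEnd ℝ) (1 - μ) * (ε * inner ℝ z y) ≤ 0 := by
      have : (starRingEnd ℝ) (1 - μ) = 1 - μ := rfl
      rw [this]
      exact mul_nonpos_of_nonneg_of_nonpos (by linarith)
        (mul_nonpos_of_nonneg_of_nonpos hε hy)
    nlinarith [mul_nonneg hμ0 (sub_nonneg.2 hμ1), sq_nonneg t,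
      mul_nonneg (mul_nonneg hμ0 (sub_nonneg.2 hμ1)) (sq_nonneg t)]
  have h2 : x + ε • y = (x + ε • y - μ • z) + μ • z := by abel
  have h3 : q (μ • z) = μ * q z := by rw [map_smul_eq_mul, Real.norm_of_nonneg hμ0]
  calc q (x + ε • y) = q ((x + ε • y - μ • z) + μ • z) := by rw [← h2]
    _ ≤ q (x + ε • y - μ • z) + q (μ • z) := map_add_le_add q _ _
    _ ≤ 1 + μ * q z := by rw [h3]; gcongr; exact hc _ h1
    _ = _ := by rw [hμ]; ring

/-- The unit sphere of a seminorm whose unit ball is a union of balls of radius `t` has a tangent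
hyperplane at each of its points. -/
theorem exists_tangent {q : Seminorm ℝ F} {K : Set F} {t : ℝ} (ht : 0 < t)
    (hK : ∀ x, q x ≤ 1 ↔ ∃ c ∈ K, ‖x - c‖ ≤ t) {x : F} (hx : q x = 1) :
    ∃ z : F, inner ℝ z x ≠ 0 ∧ ∀ y, inner ℝ z y = 0 →
      ∃ b ε₀ : ℝ, 0 < ε₀ ∧ ∀ ε, 0 ≤ ε → ε ≤ ε₀ → q (x + ε • y) ≤ 1 + b * ε ^ 2 := by
  obtain ⟨c, hcK, hxc⟩ := (hK x).1 hx.le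
  have hc : ∀ w, ‖w - c‖ ≤ t → q w ≤ 1 := fun w hw => (hK w).2 ⟨c, hcK, hw⟩
  have key : ∀ y, inner ℝ (x - c) y ≤ 0 →
      ∃ b ε₀ : ℝ, 0 < ε₀ ∧ ∀ ε, 0 ≤ ε → ε ≤ ε₀ → q (x + ε • y) ≤ 1 + b * ε ^ 2 := by
    intro y hy
    refine ⟨_, t / (‖y‖ + 1), by positivity, fun ε h0 h1 =>
      seminorm_add_smul_le ht hc hxc hy h0 ?_⟩
    rw [le_div_iff₀ (by positivity)] at h1
    nlinarith
  refine ⟨x - c, fun h0 => ?_, fun y hy => key y hy.le⟩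
  -- Otherwise the radial direction would be tangent, although `q (x + ε x) = 1 + ε` grows linearly.
  obtain ⟨b, ε₀, hε₀, h⟩ := key x h0.le
  set ε := min ε₀ (1 / (2 * (|b| + 1))) with hε
  have hεpos : 0 < ε := lt_min hε₀ (by positivity)
  have h1 := h ε hεpos.le (min_le_left _ _)
  have h2 : x + ε • x = (1 + ε) • x := by module
  rw [h2, map_smul_eq_mul, hx, Real.norm_of_nonneg (by linarith)] at h1
  have h3 : ε ≤ 1 / (2 * (|b| + 1)) := min_le_right _ _
  rw [le_div_iff₀ (by positivity)] at h3
  nlinarith [le_abs_self b, abs_nonneg b]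

end Smooth

/-! ### The norm with corners, and why it is not smooth. -/

section Corner

variable {F : Type*} [NormedAddCommGroup F] [InnerProductSpace ℝ F]

/-- A sequence that is dense in `[s, 1]`. -/
noncomputable def level (s : ℝ) (k : ℕ) : ℝ := max s (min 1 |TopologicalSpace.denseSeq ℝ k|)

theorem level_nonneg (s : ℝ) (k : ℕ) : 0 ≤ level s k :=
  le_max_of_le_right (le_min zero_le_one (abs_nonneg _))

theorem le_level (s : ℝ) (k : ℕ) : s ≤ level s k := le_max_left _ _

theorem level_le_one {s : ℝ} (hs : s ≤ 1) (k : ℕ) : level s k ≤ 1 := max_le hs (min_le_left _ _)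

theorem level_le (s : ℝ) (k : ℕ) : level s k ≤ max s 1 := max_le_max le_rfl (min_le_left _ _)

theorem exists_level_mem_Ioo {s a b : ℝ} (hs : 0 ≤ s) (ha : s ≤ a) (hab : a < b) (hb : b ≤ 1) :
    ∃ k, level s k ∈ Ioo a b := by
  obtain ⟨k, h1, h2⟩ :=
    (TopologicalSpace.denseRange_denseSeq ℝ).exists_mem_open isOpen_Ioo (nonempty_Ioo.2 hab)
  refine ⟨k, ?_⟩
  rw [level, abs_of_nonneg (by linarith), min_eq_right (by linarith), max_eq_right (by linarith)]
  exact ⟨h1, h2⟩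

/-- The `k`-th summand of `cornerSeminorm`. -/
noncomputable def cornerTerm (s : ℝ) (p : Seminorm ℝ F) (k : ℕ) (x : F) : ℝ :=
  (1 / 2) ^ (k + 1) * max ‖x‖ (level s k * p x)

/-- The weights sum to `1`, so a bound shared by all the maxima passes to `cornerSeminorm`. -/
theorem hasSum_half_pow_mul (r : ℝ) : HasSum (fun k : ℕ => (1 / 2 : ℝ) ^ (k + 1) * r) r := by
  have h := (hasSum_geometric_two' r)
  convert h using 2 with k
  rw [pow_succ, one_div, inv_pow]
  ring

variable (s : ℝ) (p : Seminorm ℝ F)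

theorem summable_cornerTerm (x : F) : Summable fun k => cornerTerm s p k x := by
  refine Summable.of_nonneg_of_le (fun k => ?_) (fun k => ?_)
    (hasSum_half_pow_mul (max ‖x‖ (max s 1 * p x))).summable
  · exact mul_nonneg (by positivity) (le_max_of_le_left (norm_nonneg x))
  · exact mul_le_mul_of_nonneg_left
      (max_le_max le_rfl (mul_le_mul_of_nonneg_right (level_le s k) (apply_nonneg p x)))
      (by positivity)

theorem cornerTerm_add_le (k : ℕ) (x y : F) :
    cornerTerm s p k (x + y) ≤ cornerTerm s p k x + cornerTerm s p k y := by
  rw [cornerTerm, cornerTerm, cornerTerm, ← mul_add]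
  refine mul_le_mul_of_nonneg_left (max_le ?_ ?_) (by positivity)
  · exact (norm_add_le x y).trans (add_le_add (le_max_left _ _) (le_max_left _ _))
  · refine le_trans ?_ (add_le_add (le_max_right _ _) (le_max_right _ _))
    rw [← mul_add]
    exact mul_le_mul_of_nonneg_left (map_add_le_add p x y) (level_nonneg s k)

theorem cornerTerm_smul (k : ℕ) (a : ℝ) (x : F) :
    cornerTerm s p k (a • x) = ‖a‖ * cornerTerm s p k x := by
  rw [cornerTerm, cornerTerm, norm_smul, map_smul_eq_mul, mul_left_comm (level s k),
    ← mul_max_of_nonneg _ _ (norm_nonneg a)]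
  ring

/-- The seminorm `∑ₖ 2⁻⁽ᵏ⁺¹⁾ max (‖x‖, aₖ p(x))`, where `aₖ` runs through a dense subset of
`[s, 1]`. It has corners on a dense set of level sets of `‖x‖ / p(x)`. -/
noncomputable def cornerSeminorm : Seminorm ℝ F :=
  Seminorm.of (fun x => ∑' k, cornerTerm s p k x)
    (fun x y => by
      rw [← (summable_cornerTerm s p x).tsum_add (summable_cornerTerm s p y)]
      exact (summable_cornerTerm s p _).tsum_le_tsum (fun k => cornerTerm_add_le s p k x y)
        ((summable_cornerTerm s p x).add (summable_cornerTerm s p y)))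
    (fun a x => by
      simp only [cornerTerm_smul]
      exact tsum_mul_left)

theorem hasSum_cornerSeminorm (x : F) :
    HasSum (fun k => cornerTerm s p k x) (cornerSeminorm s p x) :=
  (summable_cornerTerm s p x).hasSum

variable {s p}

theorem norm_le_cornerSeminorm (x : F) : ‖x‖ ≤ cornerSeminorm s p x :=
  hasSum_le (fun _ => mul_le_mul_of_nonneg_left (le_max_left _ _) (by positivity))
    (hasSum_half_pow_mul ‖x‖) (hasSum_cornerSeminorm s p x)

theorem mul_le_cornerSeminorm (x : F) : s * p x ≤ cornerSeminorm s p x :=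
  hasSum_le (fun k => mul_le_mul_of_nonneg_left
      ((mul_le_mul_of_nonneg_right (le_level s k) (apply_nonneg p x)).trans (le_max_right _ _))
      (by positivity))
    (hasSum_half_pow_mul (s * p x)) (hasSum_cornerSeminorm s p x)

theorem cornerSeminorm_le (hs : s ≤ 1) {x : F} (hx : ‖x‖ ≤ p x) : cornerSeminorm s p x ≤ p x :=
  hasSum_le (fun k => mul_le_mul_of_nonneg_left
      (max_le hx (mul_le_of_le_one_left (apply_nonneg p x) (level_le_one hs k))) (by positivity))
    (hasSum_cornerSeminorm s p x) (hasSum_half_pow_mul (p x))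

/-- Some level lies strictly above `‖x‖ / p x`, and its summand alone makes the inequality strict.
This keeps the new body different from the ball. -/
theorem norm_lt_cornerSeminorm (hs0 : 0 ≤ s) (hs : s < 1) {x : F} (hx : ‖x‖ < p x) :
    ‖x‖ < cornerSeminorm s p x := by
  have hp : 0 < p x := (norm_nonneg x).trans_lt hx
  obtain ⟨k, hk, -⟩ := exists_level_mem_Ioo hs0 (le_max_left s (‖x‖ / p x))
    (max_lt hs ((div_lt_one hp).2 hx)) le_rfl
  have hk' : ‖x‖ < level s k * p x := (div_lt_iff₀ hp).1 ((le_max_right _ _).trans_lt hk)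
  have hle : (fun j : ℕ => (1 / 2 : ℝ) ^ (j + 1) * ‖x‖) ≤ fun j => cornerTerm s p j x :=
    fun _ => mul_le_mul_of_nonneg_left (le_max_left _ _) (by positivity)
  have hlt : (1 / 2 : ℝ) ^ (k + 1) * ‖x‖ < cornerTerm s p k x :=
    mul_lt_mul_of_pos_left (hk'.trans_le (le_max_right _ _)) (by positivity)
  exact hasSum_lt hle hlt (hasSum_half_pow_mul ‖x‖) (hasSum_cornerSeminorm s p x)

/-- Each summand is monotone and homogeneous in the pair of norms; continuity of the second map
rests on this. -/
theorem cornerSeminorm_le_mul {p' : Seminorm ℝ F} {x y : F} {r : ℝ} (hn : ‖x‖ ≤ r * ‖y‖)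
    (h : p x ≤ r * p' y) : cornerSeminorm s p x ≤ r * cornerSeminorm s p' y := by
  refine hasSum_le (fun k => ?_) (hasSum_cornerSeminorm s p x)
    ((hasSum_cornerSeminorm s p' y).mul_left r)
  have hr : max ‖x‖ (level s k * p x) ≤ r * max ‖y‖ (level s k * p' y) := by
    by_cases hr : 0 ≤ r
    · refine max_le (hn.trans (mul_le_mul_of_nonneg_left (le_max_left _ _) hr)) ?_
      refine le_trans ?_ (mul_le_mul_of_nonneg_left (le_max_right _ _) hr)
      rw [mul_left_comm]
      exact mul_le_mul_of_nonneg_left h (level_nonneg s k)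
    · have hy : ‖y‖ = 0 := by nlinarith [norm_nonneg x, norm_nonneg y]
      have hx : ‖x‖ = 0 := by nlinarith [norm_nonneg x, norm_nonneg y]
      rw [norm_eq_zero] at hx hy
      simp [hx, hy]
  rw [cornerTerm, cornerTerm, mul_left_comm]
  exact mul_le_mul_of_nonneg_left hr (by positivity)

/-- The second differences of `cornerSeminorm` dominate those of its summands. -/
theorem cornerTerm_add_le_cornerSeminorm (k : ℕ) (x y : F) :
    cornerTerm s p k (x + y) + cornerTerm s p k (x - y) - 2 * cornerTerm s p k x ≤
      cornerSeminorm s p (x + y) + cornerSeminorm s p (x - y) - 2 * cornerSeminorm s p x := by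
  have h := ((hasSum_cornerSeminorm s p (x + y)).add (hasSum_cornerSeminorm s p (x - y))).sub
    ((hasSum_cornerSeminorm s p x).mul_left 2)
  -- By convexity all second differences are nonnegative, so the sum dominates any one of them.
  refine le_hasSum h k fun j _ => ?_
  have h1 := cornerTerm_add_le s p j (x + y) (x - y)
  have h2 : x + y + (x - y) = (2 : ℝ) • x := by module
  rw [h2, cornerTerm_smul, Real.norm_of_nonneg zero_le_two] at h1
  exact sub_nonneg.2 h1

/-- If `cornerSeminorm s p` is smooth, then the sphere and the unit sphere of `p`, rescaled, touch
along the level sets of `‖x‖ / p(x)` on which corners could occur. -/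
theorem inner_le_of_level {K : Set F} {t : ℝ} (ht : 0 < t)
    (hK : ∀ x, cornerSeminorm s p x ≤ 1 ↔ ∃ c ∈ K, ‖x - c‖ ≤ t) {x : F} {k : ℕ}
    (hx : ‖x‖ = level s k * p x) (y : F) :
    inner ℝ x y ≤ ‖x‖ * (level s k * p y) := by
  wlog hq : cornerSeminorm s p x = 1 generalizing x with H
  · rcases eq_or_ne x 0 with rfl | hx0
    · simp
    have hpos : 0 < cornerSeminorm s p x :=
      (norm_pos_iff.2 hx0).trans_le (norm_le_cornerSeminorm x)
    set r := (cornerSeminorm s p x)⁻¹ with hr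
    have hr0 : 0 < r := inv_pos.2 hpos
    have h1 := H (x := r • x)
      (by rw [norm_smul, map_smul_eq_mul, Real.norm_of_nonneg hr0.le, hx]; ring)
      (by rw [map_smul_eq_mul, Real.norm_of_nonneg hr0.le, hr, inv_mul_cancel₀ hpos.ne'])
    rw [inner_smul_left, norm_smul, Real.norm_of_nonneg hr0.le, mul_assoc] at h1
    exact le_of_mul_le_mul_left h1 hr0
  by_contra! hlt
  have hx0 : 0 < ‖x‖ := by
    rw [norm_pos_iff]
    rintro rfl
    simp at hq
  set a := level s k
  set η := inner ℝ x y / ‖x‖ - a * p y with hη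
  have hη0 : 0 < η := by
    rw [hη, sub_pos, lt_div_iff₀ hx0, mul_comm]
    exact hlt
  obtain ⟨z, hzx, hz⟩ := exists_tangent ht hK hq
  -- A radial correction makes `y - α x` tangent, so the second difference of the whole seminorm in
  -- this direction is `O(ε²)`.
  set α := inner ℝ z y / inner ℝ z x with hα
  have hzy : inner ℝ z (y - α • x) = 0 := by
    rw [inner_sub_right, inner_smul_right, hα, div_mul_cancel₀ _ hzx, sub_self]
  obtain ⟨b₁, ε₁, hε₁, h₁⟩ := hz _ hzy
  obtain ⟨b₂, ε₂, hε₂, h₂⟩ := hz (-(y - α • x)) (by rw [inner_neg_right, hzy, neg_zero])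
  set w : ℝ := (1 / 2) ^ (k + 1) with hw
  have hw0 : 0 < w := by positivity
  set ε := min (min ε₁ ε₂) (min (1 / (|α| + 1)) (w * η / (|b₁ + b₂| + 1))) with hε
  have hε0 : 0 < ε := by positivity
  have hεα : ε * (|α| + 1) ≤ 1 :=
    (le_div_iff₀ (by positivity)).1 ((min_le_right _ _).trans (min_le_left _ _))
  have hεb : ε * (|b₁ + b₂| + 1) ≤ w * η :=
    (le_div_iff₀ (by positivity)).1 ((min_le_right _ _).trans (min_le_right _ _))
  have hα1 : |ε * α| ≤ 1 := by
    rw [abs_mul, abs_of_pos hε0]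
    nlinarith
  obtain ⟨hα2, hα3⟩ := abs_le.1 hα1
  have hplus := h₁ ε hε0.le ((min_le_left _ _).trans (min_le_left _ _))
  have hminus := h₂ ε hε0.le ((min_le_left _ _).trans (min_le_right _ _))
  rw [smul_neg, ← sub_eq_add_neg] at hminus
  have hdiff := cornerTerm_add_le_cornerSeminorm (s := s) (p := p) k x (ε • (y - α • x))
  have hT : cornerTerm s p k x = w * ‖x‖ := by
    rw [cornerTerm, ← hx, max_self]
  -- Bounding the maximum below by the norm on the plus side and by `a p` on the minus side makes
  -- the `α` terms cancel and leaves a second difference of at least `w ε η`, linear in `ε`.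
  have hTplus : w * ((1 - ε * α) * ‖x‖ + ε * (inner ℝ x y / ‖x‖)) ≤
      cornerTerm s p k (x + ε • (y - α • x)) := by
    refine mul_le_mul_of_nonneg_left (le_max_of_le_left ?_) hw0.le
    have h3 := real_inner_le_norm x (x + ε • (y - α • x))
    have h4 : inner ℝ x (x + ε • (y - α • x)) =
        ‖x‖ * ((1 - ε * α) * ‖x‖ + ε * (inner ℝ x y / ‖x‖)) := by
      rw [inner_add_right, inner_smul_right, inner_sub_right, inner_smul_right,
        real_inner_self_eq_norm_sq]
      field_simp
      ring
    rw [h4] at h3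
    exact le_of_mul_le_mul_left h3 hx0
  have hTminus : w * ((1 + ε * α) * ‖x‖ - ε * (a * p y)) ≤
      cornerTerm s p k (x - ε • (y - α • x)) := by
    refine mul_le_mul_of_nonneg_left (le_max_of_le_right ?_) hw0.le
    have h3 : (1 + ε * α) * p x ≤ p (x - ε • (y - α • x)) + ε * p y := by
      have h4 : (1 + ε * α) • x = (x - ε • (y - α • x)) + ε • y := by module
      have h5 := map_add_le_add p (x - ε • (y - α • x)) (ε • y)
      rw [← h4, map_smul_eq_mul, map_smul_eq_mul, Real.norm_of_nonneg hε0.le,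
        Real.norm_of_nonneg (by linarith)] at h5
      exact h5
    have h6 := mul_le_mul_of_nonneg_left h3 (level_nonneg s k)
    rw [hx]
    linarith
  rw [hq, hT] at hdiff
  have hfin : ε * (w * η) ≤ ε * (ε * (b₁ + b₂)) := by
    rw [hη]
    nlinarith
  have := le_of_mul_le_mul_left hfin hε0
  nlinarith [le_abs_self (b₁ + b₂)]

/-- Along a segment, `‖x‖ / p(x)` is constant if `cornerSeminorm s p` is smooth and the segment
starts at a point at which `p` agrees with the norm. -/
theorem norm_eq_of_smooth_cornerSeminorm {K : Set F} {t : ℝ} (ht : 0 < t) (hs0 : 0 < s) (hs : s < 1)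
    (hp : Continuous p) (hnp : ∀ x, ‖x‖ ≤ p x)
    (hK : ∀ x, cornerSeminorm s p x ≤ 1 ↔ ∃ c ∈ K, ‖x - c‖ ≤ t) {u v : F} (hu : u ≠ 0)
    (hpu : ‖u‖ = p u) : ‖v‖ = p v := by
  rcases eq_or_ne v 0 with rfl | hv
  · simp
  set γ : ℝ → F := fun a => u + a • (v - u) with hγ
  have hγc : Continuous γ := by fun_prop
  -- If the segment meets `0`, then `v` is a multiple of `u` and homogeneity suffices.
  by_cases h0 : ∃ a ∈ Icc (0 : ℝ) 1, γ a = 0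
  · obtain ⟨a, -, ha⟩ := h0
    have ha0 : a ≠ 0 := by
      rintro rfl
      simp [hγ, hu] at ha
    have hav : v = (-((1 - a) / a)) • u := by
      have h1 : a • v = (-(1 - a)) • u := by
        rw [← sub_eq_zero, ← ha, hγ]
        module
      rw [← inv_smul_smul₀ ha0 v, h1, smul_smul]
      congr 1
      field_simp
    rw [hav, norm_smul, map_smul_eq_mul, hpu]
  push Not at h0
  have hpos : ∀ x : F, x ≠ 0 → 0 < p x := fun x hx => (norm_pos_iff.2 hx).trans_le (hnp x)
  obtain ⟨a₀, ha₀, hmin⟩ := isCompact_Icc.exists_isMinOn (nonempty_Icc.2 (zero_le_one (α := ℝ)))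
    (hγc.norm.continuousOn)
  set m := ‖γ a₀‖ with hm
  have hm0 : 0 < m := norm_pos_iff.2 (h0 a₀ ha₀)
  have hmle : ∀ a ∈ Icc (0 : ℝ) 1, m ≤ ‖γ a‖ := fun a ha => hmin ha
  set ρ : ℝ → ℝ := fun a => ‖γ a‖ / p (γ a) with hρ
  have hρc : ContinuousOn ρ (Icc 0 1) :=
    hγc.norm.continuousOn.div (hp.comp hγc).continuousOn fun a ha => (hpos _ (h0 a ha)).ne'
  have hρ1 : ∀ a ∈ Icc (0 : ℝ) 1, ρ a ≤ 1 := fun a ha =>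
    (div_le_one (hpos _ (h0 a ha))).2 (hnp _)
  set b := ‖v - u‖ ^ 2 / (2 * m ^ 2) with hb
  have hb0 : 0 ≤ b := by positivity
  have hlevel : ∀ a ∈ Icc (0 : ℝ) 1, ∀ a' ∈ Icc (0 : ℝ) 1, ∀ k, ρ a' = level s k →
      ρ a - ρ a' ≤ b * (a - a') ^ 2 := by
    intro a ha a' ha' k hk
    have hx := hpos _ (h0 a' ha')
    have hy := hpos _ (h0 a ha)
    have h1 := inner_le_of_level ht hK (x := γ a') (k := k)
      (by rw [← hk, hρ]; field_simp) (γ a)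
    rw [← hk] at h1
    have hnx := hm0.trans_le (hmle a' ha')
    have hny := hm0.trans_le (hmle a ha)
    have h2 : ‖γ a - γ a'‖ ^ 2 = ‖v - u‖ ^ 2 * (a - a') ^ 2 := by
      have : γ a - γ a' = (a - a') • (v - u) := by rw [hγ]; module
      rw [this, norm_smul, mul_pow, Real.norm_eq_abs, sq_abs, mul_comm]
    rw [norm_sub_sq_real, real_inner_comm] at h2
    have h3 : ρ a * p (γ a) = ‖γ a‖ := by rw [hρ]; field_simp
    have hρa : 0 < ρ a := by rw [hρ]; positivity
    have h4 : ρ a * inner ℝ (γ a') (γ a) ≤ ‖γ a'‖ * ρ a' * ‖γ a‖ := by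
      rw [← h3]
      nlinarith [mul_le_mul_of_nonneg_left h1 hρa.le]
    -- Uses `ρ a ≤ 1` and `‖x‖ ‖y‖ - ⟪x, y⟫ ≤ ‖x - y‖² / 2`; the minimum `m` of the norm on the
    -- segment permits the later division.
    have h5 : (ρ a - ρ a') * (‖γ a'‖ * ‖γ a‖) ≤ b * (a - a') ^ 2 * m ^ 2 := by
      have h6 : ‖γ a'‖ * ‖γ a‖ - inner ℝ (γ a') (γ a) ≤ b * (a - a') ^ 2 * m ^ 2 := by
        have h7 : b * (a - a') ^ 2 * m ^ 2 = (‖v - u‖ ^ 2 * (a - a') ^ 2) / 2 := by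
          rw [hb]; field_simp
        rw [h7, ← h2]
        nlinarith [sq_nonneg (‖γ a‖ - ‖γ a'‖)]
      have h8 : 0 ≤ ‖γ a'‖ * ‖γ a‖ - inner ℝ (γ a') (γ a) :=
        sub_nonneg.2 (real_inner_le_norm _ _)
      nlinarith [mul_le_mul_of_nonneg_right (hρ1 a ha) h8]
    by_contra! hcon
    have hm2 : m ^ 2 ≤ ‖γ a'‖ * ‖γ a‖ := by
      rw [sq]
      exact mul_le_mul (hmle a' ha') (hmle a ha) hm0.le hnx.le
    have h9 : 0 ≤ b * (a - a') ^ 2 := by positivity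
    nlinarith [mul_le_mul hcon.le hm2 (by positivity) (h9.trans hcon.le),
      mul_lt_mul_of_pos_right hcon (by positivity : 0 < ‖γ a'‖ * ‖γ a‖)]
  -- Truncation at `s` is needed because levels exist only in `[s, 1]`. A level slightly above `max
  -- s (ρ a')` is attained between `a'` and `a`, so the bound at levels applies with no larger
  -- distance and a loss below `η`.
  have hψ : ∀ a ∈ Icc (0 : ℝ) 1, ∀ a' ∈ Icc (0 : ℝ) 1,
      max s (ρ a) - max s (ρ a') ≤ b * (a - a') ^ 2 := by
    intro a ha a' ha'
    rcases le_or_gt (max s (ρ a)) (max s (ρ a')) with hle | hlt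
    · exact (sub_nonpos.2 hle).trans (by positivity)
    have hsρ : max s (ρ a) = ρ a := max_eq_right (by
      by_contra! hcon
      rw [max_eq_left hcon.le] at hlt
      exact absurd (le_max_left s (ρ a')) (not_le.2 hlt))
    rw [hsρ] at hlt ⊢
    refine le_of_forall_pos_lt_add fun η hη => ?_
    set d := min (η / 2) ((ρ a - max s (ρ a')) / 2) with hd
    have hd0 : 0 < d := lt_min (by linarith) (by linarith)
    have hd1 : d ≤ η / 2 := min_le_left _ _
    have hd2 : d ≤ (ρ a - max s (ρ a')) / 2 := min_le_right _ _
    have hsm := le_max_left s (ρ a')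
    have hρm := le_max_right s (ρ a')
    obtain ⟨k₁, hk₁, hk₁'⟩ := exists_level_mem_Ioo hs0.le hsm
      (by linarith : max s (ρ a') < max s (ρ a') + d) (by linarith [hρ1 a ha])
    have hsub : uIcc a' a ⊆ Icc 0 1 := uIcc_subset_Icc ha' ha
    obtain ⟨c', hc', hc'ρ⟩ := intermediate_value_uIcc (hρc.mono hsub)
      (mem_uIcc_of_le (by linarith : ρ a' ≤ level s k₁) (by linarith))
    have h1 := hlevel a ha c' (hsub hc') k₁ hc'ρ
    have h2 : (a - c') ^ 2 ≤ (a - a') ^ 2 := by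
      rw [sq_le_sq]
      exact abs_sub_right_of_mem_uIcc hc'
    nlinarith [mul_le_mul_of_nonneg_left h2 hb0]
  have hconst := eq_of_sub_le_sq (ψ := fun a => max s (ρ a)) hψ
  have e0 : ρ 0 = 1 := by
    have : γ 0 = u := by simp [hγ]
    rw [hρ]
    simp only [this]
    rw [hpu, div_self (hpos u hu).ne']
  have e1 : ρ 1 = ‖v‖ / p v := by
    have : γ 1 = v := by simp [hγ]
    rw [hρ]
    simp only [this]
  simp only [e0, e1] at hconst
  rw [max_eq_right hs.le] at hconst
  have h1 : 1 ≤ ‖v‖ / p v := by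
    by_contra! hcon
    exact absurd hconst (max_lt hs hcon).ne'
  rw [one_le_div (hpos v hv)] at h1
  exact le_antisymm (hnp v) h1

end Corner

/-! ### Bodies in Löwner position: norms, contact points, continuity criterion. -/

section Bodies

open scoped Pointwise

variable {n : ℕ}

/-- Cancellation of balls in Minkowski sums. -/
theorem closedBall_subset_of_subset_add {F : Type*} [NormedAddCommGroup F] [InnerProductSpace ℝ F]
    [CompleteSpace F] {K : Set F} (hK : Convex ℝ K) (hKc : IsClosed K) {r ε : ℝ} (hε : 0 ≤ ε)
    (h : ∀ x : F, ‖x‖ ≤ r + ε → ∃ y ∈ K, ‖x - y‖ ≤ ε) {x : F} (hx : ‖x‖ ≤ r) : x ∈ K := by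
  by_contra hxK
  obtain ⟨f, b, hfb, hbx⟩ := geometric_hahn_banach_closed_point hK hKc hxK
  set w := (InnerProductSpace.toDual ℝ F).symm f with hw
  have hf : ∀ y, f y = inner ℝ w y := fun y => by
    rw [hw, InnerProductSpace.toDual_symm_apply]
  have hr : 0 ≤ r := (norm_nonneg x).trans hx
  -- The point of the `ε`-ball where the separating functional is largest; if `w = 0`, division by
  -- zero gives `z = 0`.
  set z : F := (ε / ‖w‖) • w with hz
  have hzn : ‖z‖ ≤ ε := by
    rw [hz, norm_smul, Real.norm_of_nonneg (by positivity)]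
    rcases eq_or_ne ‖w‖ 0 with h0 | h0
    · rw [h0, mul_zero]; exact hε
    · rw [div_mul_cancel₀ _ h0]
  have hfz : f z = ε * ‖w‖ := by
    rw [hf, hz, inner_smul_right, real_inner_self_eq_norm_sq]
    rcases eq_or_ne ‖w‖ 0 with h0 | h0
    · rw [h0]; simp
    · field_simp
  obtain ⟨y, hyK, hy⟩ := h (x + z) ((norm_add_le _ _).trans (add_le_add hx hzn))
  have h1 : f (x + z - y) ≤ ‖w‖ * ε := by
    rw [hf]
    exact (real_inner_le_norm _ _).trans (mul_le_mul_of_nonneg_left hy (norm_nonneg _))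
  rw [map_sub, map_add, hfz] at h1
  have := hfb y hyK
  linarith

theorem norm_le_of_mem_LE (V : LE n) {x : E n} (hx : x ∈ (V : ConvexBody (E n))) : ‖x‖ ≤ 1 :=
  mem_closedBall_zero_iff.1 (V.2.1.2.2.1 hx)

/-- Enlarging a body inside the unit ball preserves the Löwner ellipsoid. -/
theorem mem_LE_of_subset (V : LE n) {W : ConvexBody (E n)} (hsymm : ∀ x ∈ W, -x ∈ W)
    (hVW : ((V : ConvexBody (E n)) : Set (E n)) ⊆ W) (hW : ∀ x ∈ W, ‖x‖ ≤ 1)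
    (hne : ∃ x : E n, ‖x‖ ≤ 1 ∧ x ∉ W) : W ∈ LE n := by
  obtain ⟨⟨⟨hint, -⟩, hball, -, hmin⟩, -⟩ := V.2
  refine ⟨⟨⟨hint.mono (interior_mono hVW), hsymm⟩, hball,
    fun x hx => mem_closedBall_zero_iff.2 (hW x hx),
    fun S' hS' hWS' => hmin S' hS' (hVW.trans hWS')⟩, ?_⟩
  rintro rfl
  obtain ⟨x, hx, hxW⟩ := hne
  exact hxW (mem_closedBall_zero_iff.2 hx)

theorem exists_notMem (V : LE n) : ∃ x : E n, ‖x‖ ≤ 1 ∧ x ∉ (V : ConvexBody (E n)) := by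
  by_contra! h
  exact V.2.2 (ConvexBody.ext (Subset.antisymm V.2.1.2.2.1
    fun x hx => h x (mem_closedBall_zero_iff.1 hx)))

theorem neg_mem_LE (V : LE n) {x : E n} (hx : x ∈ (V : ConvexBody (E n))) :
    -x ∈ (V : ConvexBody (E n)) := V.2.1.1.2 x hx

theorem zero_mem_LE (V : LE n) : (0 : E n) ∈ (V : ConvexBody (E n)) :=
  ConvexBody.zero_mem_of_symmetric _ V.2.1.1.2

theorem LE_mem_nhds (V : LE n) : ((V : ConvexBody (E n)) : Set (E n)) ∈ nhds 0 := by
  obtain ⟨x, hx⟩ := V.2.1.1.1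
  have hneg : -x ∈ ((V : ConvexBody (E n)) : Set (E n)) := neg_mem_LE V (interior_subset hx)
  have h := (V : ConvexBody (E n)).convex.combo_interior_self_mem_interior hx hneg
    (a := 1 / 2) (b := 1 / 2) (by norm_num) (by norm_num) (by norm_num)
  rw [smul_neg, add_neg_cancel] at h
  exact mem_interior_iff_mem_nhds.1 h

theorem LE_balanced (V : LE n) : Balanced ℝ ((V : ConvexBody (E n)) : Set (E n)) := by
  rw [balanced_iff_smul_mem]
  intro a ha x hx
  have h0 := zero_mem_LE V
  rcases le_total 0 a with h | h
  · rw [Real.norm_of_nonneg h] at ha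
    exact (V : ConvexBody (E n)).convex.smul_mem_of_zero_mem h0 hx ⟨h, ha⟩
  · rw [Real.norm_of_nonpos h] at ha
    have := (V : ConvexBody (E n)).convex.smul_mem_of_zero_mem h0 (neg_mem_LE V hx)
      ⟨neg_nonneg.2 h, ha⟩
    rwa [neg_smul_neg] at this

/-- The norm whose unit ball is `V`. -/
noncomputable def bodyNorm (V : LE n) : Seminorm ℝ (E n) :=
  gaugeSeminorm (LE_balanced V) (V : ConvexBody (E n)).convex (absorbent_nhds_zero (LE_mem_nhds V))

theorem continuous_bodyNorm (V : LE n) : Continuous (bodyNorm V) :=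
  continuous_gauge (V : ConvexBody (E n)).convex (LE_mem_nhds V)

theorem bodyNorm_le_one_iff {V : LE n} {x : E n} :
    bodyNorm V x ≤ 1 ↔ x ∈ (V : ConvexBody (E n)) :=
  (gauge_le_one_iff_mem_closure (V : ConvexBody (E n)).convex (LE_mem_nhds V)).trans
    (by rw [(V : ConvexBody (E n)).isClosed.closure_eq]; rfl)

theorem norm_le_bodyNorm (V : LE n) (x : E n) : ‖x‖ ≤ bodyNorm V x := by
  have h := le_gauge_of_subset_closedBall (x := x) (absorbent_nhds_zero (LE_mem_nhds V))
    zero_le_one V.2.1.2.2.1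
  rwa [div_one] at h

/-- By homogeneity a bound on the unit ball suffices. Taking `f` to be the identity serves
continuity, and an isometry serves equivariance. -/
theorem bodyNorm_map_le {V V' : LE n} {r : ℝ} (f : E n →ₗ[ℝ] E n)
    (h : ∀ x ∈ (V' : ConvexBody (E n)), bodyNorm V (f x) ≤ r) (x : E n) :
    bodyNorm V (f x) ≤ r * bodyNorm V' x := by
  rcases eq_or_ne x 0 with rfl | hx
  · simp
  have hp : 0 < bodyNorm V' x := (norm_pos_iff.2 hx).trans_le (norm_le_bodyNorm V' x)
  have h1 := h ((bodyNorm V' x)⁻¹ • x) (bodyNorm_le_one_iff.1 (by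
    rw [map_smul_eq_mul, Real.norm_of_nonneg (inv_nonneg.2 hp.le), inv_mul_cancel₀ hp.ne']))
  rw [map_smul, map_smul_eq_mul, Real.norm_of_nonneg (inv_nonneg.2 hp.le),
    inv_mul_le_iff₀ hp, mul_comm] at h1
  exact h1

theorem mem_smul_LE {g : O n} {V : LE n} {x : E n} :
    x ∈ ((g • V : LE n) : ConvexBody (E n)) ↔ g.symm x ∈ (V : ConvexBody (E n)) := by
  constructor
  · rintro ⟨y, hy, rfl⟩
    rw [g.symm_apply_apply]
    exact hy
  · intro h
    exact ⟨_, h, g.apply_symm_apply x⟩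

theorem bodyNorm_smul (g : O n) (V : LE n) (x : E n) :
    bodyNorm (g • V) x = bodyNorm V (g.symm x) := by
  refine le_antisymm ?_ ?_
  · have h := bodyNorm_map_le (V := g • V) (V' := V) (r := 1) g.toLinearEquiv.toLinearMap
      (fun y hy => bodyNorm_le_one_iff.2 (mem_smul_LE.2 (by
        change g.symm (g y) ∈ _
        rwa [g.symm_apply_apply]))) (g.symm x)
    change bodyNorm (g • V) (g (g.symm x)) ≤ _ at h
    rwa [g.apply_symm_apply, one_mul] at h
  · have h := bodyNorm_map_le (V := V) (V' := g • V) (r := 1) g.symm.toLinearEquiv.toLinearMap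
      (fun y hy => bodyNorm_le_one_iff.2 (mem_smul_LE.1 hy)) x
    rwa [one_mul] at h

/-- A body in Löwner position touches the unit sphere. -/
theorem exists_contact (V : LE n) : ∃ u : E n, u ≠ 0 ∧ ‖u‖ = bodyNorm V u := by
  obtain ⟨u, hu, hmax⟩ := (V : ConvexBody (E n)).isCompact.exists_isMaxOn
    (V : ConvexBody (E n)).nonempty continuous_norm.continuousOn
  obtain ⟨v, hv1, hv⟩ := exists_notMem V
  have hv0 : v ≠ 0 := fun h => hv (h ▸ zero_mem_LE V)
  have hnt : Nontrivial (E n) := ⟨v, 0, hv0⟩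
  have hub : ∀ x ∈ (V : ConvexBody (E n)), ‖x‖ ≤ ‖u‖ := fun x hx => hmax hx
  have hu0 : u ≠ 0 := by
    rintro rfl
    have hp : 0 < bodyNorm V v := (norm_pos_iff.2 hv0).trans_le (norm_le_bodyNorm V v)
    have h1 := hub ((bodyNorm V v)⁻¹ • v) (bodyNorm_le_one_iff.1 (by
      rw [map_smul_eq_mul, Real.norm_of_nonneg (inv_nonneg.2 hp.le), inv_mul_cancel₀ hp.ne']))
    rw [norm_zero, norm_le_zero_iff, smul_eq_zero] at h1
    exact h1.elim (inv_ne_zero hp.ne') hv0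
  have hpos : 0 < ‖u‖ := norm_pos_iff.2 hu0
  have h1 : 1 ≤ ‖u‖ := by
    by_contra! hlt
    -- Otherwise the ball of radius `‖u‖ < 1` is an ellipsoid containing `V` of smaller volume than
    -- `Bⁿ`.
    set T : E n ≃ₗ[ℝ] E n := LinearEquiv.smulOfUnit (Units.mk0 ‖u‖ hpos.ne') with hT
    have himg : T '' Metric.closedBall (0 : E n) 1 = Metric.closedBall 0 ‖u‖ := by
      have : (T : E n → E n) = fun x => ‖u‖ • x := rfl
      rw [this, image_smul, smul_unitClosedBall_of_nonneg hpos.le]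
    have hle := V.2.1.2.2.2 (Metric.closedBall 0 ‖u‖) ⟨T, himg.symm⟩
      (fun x hx => mem_closedBall_zero_iff.2 (hub x hx))
    refine absurd hle (not_le.2 ?_)
    change volume (Metric.closedBall (0 : E n) ‖u‖) < volume (Metric.closedBall (0 : E n) 1)
    have h2 := Measure.addHaar_closedBall_mul (volume : Measure (E n)) (0 : E n) hpos.le
      zero_le_one
    rw [mul_one] at h2
    rw [h2]
    have h3 : volume (Metric.closedBall (0 : E n) 1) ≠ 0 :=
      (Metric.measure_closedBall_pos volume _ one_pos).ne'
    have h4 : volume (Metric.closedBall (0 : E n) 1) ≠ ⊤ :=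
      (isCompact_closedBall _ _).measure_lt_top.ne
    conv_rhs => rw [← one_mul (volume (Metric.closedBall (0 : E n) 1))]
    refine (ENNReal.mul_lt_mul_iff_left h3 h4).2 ?_
    rw [ENNReal.ofReal_lt_one]
    exact pow_lt_one₀ hpos.le hlt Module.finrank_pos.ne'
  exact ⟨u, hu0, le_antisymm (norm_le_bodyNorm V u) ((bodyNorm_le_one_iff.2 hu).trans h1)⟩

theorem exists_dist_lt {V W : LE n} {r : ℝ} (h : dist V W < r) {x : E n}
    (hx : x ∈ (V : ConvexBody (E n))) : ∃ y ∈ (W : ConvexBody (E n)), ‖x - y‖ < r := by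
  obtain ⟨y, hy, hxy⟩ := Metric.exists_dist_lt_of_hausdorffDist_lt
    (s := ((V : ConvexBody (E n)) : Set (E n))) (t := ((W : ConvexBody (E n)) : Set (E n)))
    hx h ConvexBody.hausdorffEDist_ne_top
  exact ⟨y, hy, by rwa [← dist_eq_norm]⟩

theorem dist_LE_le {V W : LE n} {r : ℝ} (hr : 0 ≤ r)
    (h : ∀ x ∈ (V : ConvexBody (E n)), ∃ y ∈ (W : ConvexBody (E n)), ‖x - y‖ ≤ r)
    (h' : ∀ x ∈ (W : ConvexBody (E n)), ∃ y ∈ (V : ConvexBody (E n)), ‖x - y‖ ≤ r) :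
    dist V W ≤ r := by
  refine Metric.hausdorffDist_le_of_mem_dist
    (s := ((V : ConvexBody (E n)) : Set (E n))) (t := ((W : ConvexBody (E n)) : Set (E n))) hr ?_ ?_
  · exact fun x hx => (h x hx).imp fun y hy => ⟨hy.1, by rw [dist_eq_norm]; exact hy.2⟩
  · exact fun x hx => (h' x hx).imp fun y hy => ⟨hy.1, by rw [dist_eq_norm]; exact hy.2⟩

/-- Bodies that contain each other up to a factor `r` are at distance at most `r - 1`. -/
theorem dist_LE_le_of_inv_smul_mem {V W : LE n} {r : ℝ} (hr : 1 ≤ r)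
    (h : ∀ x ∈ (V : ConvexBody (E n)), r⁻¹ • x ∈ (W : ConvexBody (E n)))
    (h' : ∀ x ∈ (W : ConvexBody (E n)), r⁻¹ • x ∈ (V : ConvexBody (E n))) :
    dist V W ≤ r - 1 := by
  have key : ∀ x : E n, ‖x‖ ≤ 1 → ‖x - r⁻¹ • x‖ ≤ r - 1 := by
    intro x hx
    have hr0 : 0 < r := one_pos.trans_le hr
    have e : x - r⁻¹ • x = (1 - r⁻¹) • x := by module
    have h1 : r⁻¹ ≤ 1 := inv_le_one_of_one_le₀ hr
    rw [e, norm_smul, Real.norm_of_nonneg (by linarith)]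
    have h2 : r⁻¹ * r = 1 := inv_mul_cancel₀ hr0.ne'
    nlinarith [norm_nonneg x]
  exact dist_LE_le (by linarith)
    (fun x hx => ⟨_, h x hx, key x (norm_le_of_mem_LE V hx)⟩)
    (fun x hx => ⟨_, h' x hx, key x (norm_le_of_mem_LE W hx)⟩)

/-- A map that respects inclusions up to dilation is continuous. -/
theorem continuous_of_inv_smul_mem {Φ : LE n → LE n}
    (hΦ : ∀ (V V' : LE n) (r : ℝ), 1 ≤ r →
      (∀ x ∈ (V' : ConvexBody (E n)), r⁻¹ • x ∈ (V : ConvexBody (E n))) →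
      ∀ x ∈ (Φ V' : ConvexBody (E n)), r⁻¹ • x ∈ (Φ V : ConvexBody (E n))) :
    Continuous Φ := by
  rw [Metric.continuous_iff]
  intro V η hη
  obtain ⟨R, hR, hRV⟩ := Metric.nhds_basis_closedBall.mem_iff.1 (LE_mem_nhds V)
  set ε := min (R / 2) (η * R / 4) with hε
  have hε0 : 0 < ε := by positivity
  have hεR : ε ≤ R / 2 := min_le_left _ _
  refine ⟨ε, hε0, fun V' hd => ?_⟩
  -- The `R`-ball lies in `V`, hence in `V' + ε Bⁿ`; cancelling `ε Bⁿ` leaves the `R / 2`-ball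
  -- inside `V'`.
  have hRV' : ∀ x : E n, ‖x‖ ≤ R / 2 → x ∈ (V' : ConvexBody (E n)) := fun x hx =>
    closedBall_subset_of_subset_add (V' : ConvexBody (E n)).convex
      (V' : ConvexBody (E n)).isClosed hε0.le (fun y hy => by
        obtain ⟨z, hz, hyz⟩ := exists_dist_lt (dist_comm V' V ▸ hd)
          (hRV (mem_closedBall_zero_iff.2 (by linarith : ‖y‖ ≤ R)))
        exact ⟨z, hz, hyz.le⟩) hx
  -- A body containing the `R / 2`-ball absorbs an `ε`-error when dilated by this factor.
  set r := 1 + 2 * ε / R with hr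
  have hr1 : 1 ≤ r := by rw [hr]; linarith [div_nonneg (by linarith : 0 ≤ 2 * ε) hR.le]
  have hr0 : 0 < r := by linarith
  have key : ∀ W W' : LE n, dist W W' < ε →
      (∀ x : E n, ‖x‖ ≤ R / 2 → x ∈ (W' : ConvexBody (E n))) →
      ∀ x ∈ (W : ConvexBody (E n)), r⁻¹ • x ∈ (W' : ConvexBody (E n)) := by
    intro W W' hW hball x hx
    obtain ⟨y, hy, hxy⟩ := exists_dist_lt hW hx
    have hz : (R / (2 * ε)) • (x - y) ∈ (W' : ConvexBody (E n)) := by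
      refine hball _ ?_
      rw [norm_smul, Real.norm_of_nonneg (by positivity)]
      calc R / (2 * ε) * ‖x - y‖ ≤ R / (2 * ε) * ε := by gcongr
        _ = R / 2 := by field_simp
    have hconv := (W' : ConvexBody (E n)).convex hy hz (a := r⁻¹) (b := r⁻¹ * (2 * ε / R))
      (by positivity) (by positivity) (by rw [hr]; field_simp)
    have e : r⁻¹ • y + (r⁻¹ * (2 * ε / R)) • (R / (2 * ε)) • (x - y) = r⁻¹ • x := by
      have h1 : r⁻¹ * (2 * ε / R) * (R / (2 * ε)) = r⁻¹ := by field_simp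
      rw [smul_smul, h1]
      module
    rwa [e] at hconv
  have hVR : ∀ x : E n, ‖x‖ ≤ R / 2 → x ∈ (V : ConvexBody (E n)) := fun x hx =>
    hRV (mem_closedBall_zero_iff.2 (by linarith))
  have h1 := dist_LE_le_of_inv_smul_mem hr1 (hΦ V V' r hr1 (key V' V hd hVR))
    (hΦ V' V r hr1 (key V V' (dist_comm V' V ▸ hd) hRV'))
  refine h1.trans_lt ?_
  have h2 : ε ≤ η * R / 4 := min_le_right _ _
  have h3 : 2 * ε / R ≤ η / 2 := by
    rw [div_le_iff₀ hR]
    linarith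
  rw [hr]
  linarith

theorem uniformDist_id_lt {Φ : LE n → LE n} {r δ : ℝ} (hrδ : r < δ) (hδ : 0 < δ)
    (h : ∀ V, dist (Φ V) V ≤ r) : uniformDist Φ id < ENNReal.ofReal δ := by
  refine lt_of_le_of_lt (iSup_le fun V => ?_) ((ENNReal.ofReal_lt_ofReal_iff hδ).2 hrδ)
  rw [edist_dist]
  exact ENNReal.ofReal_le_ofReal (h V)

end Bodies

/-! ### The rounding map, the cornering map and their disjoint images. -/

section Maps

open scoped Pointwise

variable {n : ℕ} {s : ℝ}

/-- The body `s V + (1 - s) Bⁿ`. -/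
noncomputable def roundedBody (s : ℝ) (V : ConvexBody (E n)) : ConvexBody (E n) :=
  s • V + (1 - s) • unitBall n

theorem mem_roundedBody (hs : s ≤ 1) {V : ConvexBody (E n)} {x : E n} :
    x ∈ roundedBody s V ↔ ∃ v ∈ V, ‖x - s • v‖ ≤ 1 - s := by
  have hball : (1 - s) • Metric.closedBall (0 : E n) 1 = Metric.closedBall 0 (1 - s) :=
    smul_unitClosedBall_of_nonneg (sub_nonneg.2 hs)
  constructor
  · rintro ⟨_, ⟨v, hv, rfl⟩, b, hb, rfl⟩
    refine ⟨v, hv, ?_⟩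
    have hb' : b ∈ (1 - s) • Metric.closedBall (0 : E n) 1 := hb
    rw [hball, mem_closedBall_zero_iff] at hb'
    simpa using hb'
  · rintro ⟨v, hv, h⟩
    refine ⟨s • v, ⟨v, hv, rfl⟩, x - s • v, ?_, by simp⟩
    change x - s • v ∈ (1 - s) • Metric.closedBall (0 : E n) 1
    rwa [hball, mem_closedBall_zero_iff]

/-- The result is not `Bⁿ`: cancelling `(1 - s) Bⁿ` from `s V + (1 - s) Bⁿ = Bⁿ` would put `s Bⁿ`
inside `s V`. -/
theorem roundedBody_mem_LE (hs0 : 0 < s) (hs : s ≤ 1) (V : LE n) :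
    roundedBody s (V : ConvexBody (E n)) ∈ LE n := by
  refine mem_LE_of_subset V ?_ ?_ ?_ ?_
  · intro x hx
    obtain ⟨v, hv, h⟩ := (mem_roundedBody hs).1 hx
    refine (mem_roundedBody hs).2 ⟨-v, neg_mem_LE V hv, ?_⟩
    rw [smul_neg, ← neg_sub', norm_neg]
    exact h
  · intro x hx
    refine (mem_roundedBody hs).2 ⟨x, hx, ?_⟩
    have e : x - s • x = (1 - s) • x := by module
    rw [e, norm_smul, Real.norm_of_nonneg (by linarith)]
    exact mul_le_of_le_one_right (by linarith) (norm_le_of_mem_LE V hx)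
  · intro x hx
    obtain ⟨v, hv, h⟩ := (mem_roundedBody hs).1 hx
    have h1 := norm_le_norm_add_norm_sub' x (s • v)
    rw [norm_smul, Real.norm_of_nonneg hs0.le] at h1
    nlinarith [norm_le_of_mem_LE V hv]
  · by_contra! hall
    obtain ⟨x, hx, hxV⟩ := exists_notMem V
    have h1 : s • x ∈ s • ((V : ConvexBody (E n)) : Set (E n)) := by
      refine closedBall_subset_of_subset_add (r := s) (ε := 1 - s)
        ((V : ConvexBody (E n)).convex.smul s) ((V : ConvexBody (E n)).isCompact.smul s).isClosed
        (by linarith) (fun y hy => ?_) ?_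
      · obtain ⟨v, hv, h⟩ := (mem_roundedBody hs).1 (hall y (by linarith))
        exact ⟨s • v, ⟨v, hv, rfl⟩, h⟩
      · rw [norm_smul, Real.norm_of_nonneg hs0.le]
        exact mul_le_of_le_one_right hs0.le hx
    obtain ⟨y, hy, hyx⟩ := h1
    exact hxV (smul_right_injective _ hs0.ne' hyx ▸ hy)

/-- The map `V ↦ s V + (1 - s) Bⁿ`. -/
noncomputable def roundedMap (hs0 : 0 < s) (hs : s ≤ 1) (V : LE n) : LE n :=
  ⟨roundedBody s V, roundedBody_mem_LE hs0 hs V⟩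

theorem continuous_roundedMap (hs0 : 0 < s) (hs : s ≤ 1) :
    Continuous (roundedMap (n := n) hs0 hs) := by
  refine continuous_of_inv_smul_mem fun V V' r hr h x hx => ?_
  obtain ⟨v, hv, hxv⟩ := (mem_roundedBody hs).1 hx
  refine (mem_roundedBody hs).2 ⟨r⁻¹ • v, h v hv, ?_⟩
  rw [smul_comm s, ← smul_sub, norm_smul, Real.norm_of_nonneg (by positivity)]
  exact (mul_le_of_le_one_left (norm_nonneg _) (inv_le_one_of_one_le₀ hr)).trans hxv

theorem roundedMap_smul (hs0 : 0 < s) (hs : s ≤ 1) (g : O n) (V : LE n) :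
    roundedMap hs0 hs (g • V) = g • roundedMap hs0 hs V := by
  refine Subtype.ext (ConvexBody.ext (Set.ext fun x => ?_))
  refine (mem_roundedBody hs).trans (Iff.trans ?_ mem_smul_LE.symm)
  refine Iff.trans ?_ (mem_roundedBody hs).symm
  constructor
  · rintro ⟨v, hv, h⟩
    refine ⟨g.symm v, mem_smul_LE.1 hv, ?_⟩
    rwa [← map_smul, ← map_sub, g.symm.norm_map]
  · rintro ⟨v, hv, h⟩
    refine ⟨g v, mem_smul_LE.2 (by rwa [g.symm_apply_apply]), ?_⟩
    rwa [← g.symm.norm_map, map_sub, map_smul, g.symm_apply_apply]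

theorem dist_roundedMap_le (hs0 : 0 < s) (hs : s ≤ 1) (V : LE n) :
    dist (roundedMap hs0 hs V) V ≤ 2 * (1 - s) := by
  refine dist_LE_le (by linarith) (fun x hx => ?_) (fun x hx => ⟨x, ?_, by simp; linarith⟩)
  · obtain ⟨v, hv, h⟩ := (mem_roundedBody hs).1 hx
    refine ⟨v, hv, ?_⟩
    have e : x - v = (x - s • v) + (-(1 - s)) • v := by module
    rw [e]
    refine (norm_add_le _ _).trans ?_
    rw [norm_smul, norm_neg, Real.norm_of_nonneg (by linarith)]
    nlinarith [norm_le_of_mem_LE V hv]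
  · refine (mem_roundedBody hs).2 ⟨x, hx, ?_⟩
    have e : x - s • x = (1 - s) • x := by module
    rw [e, norm_smul, Real.norm_of_nonneg (by linarith)]
    exact mul_le_of_le_one_right (by linarith) (norm_le_of_mem_LE V hx)

/-- The unit ball of `cornerSeminorm s p`, where `p` is the norm with unit ball `V`. -/
noncomputable def corneredBody (s : ℝ) (V : LE n) : ConvexBody (E n) where
  carrier := {x | cornerSeminorm s (bodyNorm V) x ≤ 1}
  convex' := by
    have h := (cornerSeminorm s (bodyNorm V)).convex_closedBall 0 1
    rwa [Seminorm.closedBall_zero_eq] at h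
  isCompact' := by
    refine Metric.isCompact_of_isClosed_isBounded ?_ ?_
    · have hc : Continuous (cornerSeminorm s (bodyNorm V)) :=
        (cornerSeminorm s (bodyNorm V)).convexOn.locallyLipschitz.continuous
      exact isClosed_le hc continuous_const
    · exact Metric.isBounded_closedBall.subset fun x hx =>
        mem_closedBall_zero_iff.2 ((norm_le_cornerSeminorm x).trans hx)
  nonempty' := ⟨0, by simp⟩

theorem mem_corneredBody {V : LE n} {x : E n} :
    x ∈ corneredBody s V ↔ cornerSeminorm s (bodyNorm V) x ≤ 1 := Iff.rfl

theorem mem_corneredBody_of_mem (hs : s ≤ 1) {V : LE n} {x : E n}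
    (hx : x ∈ (V : ConvexBody (E n))) : x ∈ corneredBody s V :=
  mem_corneredBody.2 ((cornerSeminorm_le hs (norm_le_bodyNorm V x)).trans
    (bodyNorm_le_one_iff.2 hx))

theorem corneredBody_mem_LE (hs0 : 0 ≤ s) (hs : s < 1) (V : LE n) :
    corneredBody s V ∈ LE n := by
  refine mem_LE_of_subset V ?_ (fun x hx => mem_corneredBody_of_mem hs.le hx) ?_ ?_
  · intro x hx
    rw [mem_corneredBody, map_neg_eq_map]
    exact hx
  · exact fun x hx => (norm_le_cornerSeminorm x).trans hx
  · obtain ⟨v, hv1, hv⟩ := exists_notMem V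
    have hv0 : 0 < ‖v‖ := norm_pos_iff.2 fun h => hv (h ▸ zero_mem_LE V)
    have hlt : ‖v‖ < bodyNorm V v := hv1.trans_lt (not_le.1 (bodyNorm_le_one_iff.not.2 hv))
    refine ⟨‖v‖⁻¹ • v, by rw [norm_smul, norm_inv, norm_norm, inv_mul_cancel₀ hv0.ne'], ?_⟩
    rw [mem_corneredBody, not_le, map_smul_eq_mul, norm_inv, norm_norm, lt_inv_mul_iff₀ hv0,
      mul_one]
    exact norm_lt_cornerSeminorm hs0 hs hlt

/-- The map that sends `V` to `corneredBody s V`. -/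
noncomputable def corneredMap (hs0 : 0 ≤ s) (hs : s < 1) (V : LE n) : LE n :=
  ⟨corneredBody s V, corneredBody_mem_LE hs0 hs V⟩

theorem continuous_corneredMap (hs0 : 0 ≤ s) (hs : s < 1) :
    Continuous (corneredMap (n := n) hs0 hs) := by
  refine continuous_of_inv_smul_mem fun V V' r hr h x hx => mem_corneredBody.2 ?_
  have hr0 : 0 < r := one_pos.trans_le hr
  have h1 : bodyNorm V x ≤ r * bodyNorm V' x :=
    bodyNorm_map_le LinearMap.id (fun y hy => by
      have h2 := bodyNorm_le_one_iff.2 (h y hy)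
      rwa [map_smul_eq_mul, Real.norm_of_nonneg (inv_nonneg.2 hr0.le), inv_mul_le_iff₀ hr0,
        mul_one] at h2) x
  have h2 := cornerSeminorm_le_mul (s := s)
    (le_mul_of_one_le_left (norm_nonneg x) hr : ‖x‖ ≤ r * ‖x‖) h1
  rw [map_smul_eq_mul, Real.norm_of_nonneg (inv_nonneg.2 hr0.le), inv_mul_le_iff₀ hr0, mul_one]
  exact h2.trans (mul_le_of_le_one_right hr0.le hx)

theorem corneredMap_smul (hs0 : 0 ≤ s) (hs : s < 1) (g : O n) (V : LE n) :
    corneredMap hs0 hs (g • V) = g • corneredMap hs0 hs V := by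
  refine Subtype.ext (ConvexBody.ext (Set.ext fun x => ?_))
  refine Iff.trans ?_ mem_smul_LE.symm
  change cornerSeminorm s (bodyNorm (g • V)) x ≤ 1 ↔
    cornerSeminorm s (bodyNorm V) (g.symm x) ≤ 1
  have h : cornerSeminorm s (bodyNorm (g • V)) x = cornerSeminorm s (bodyNorm V) (g.symm x) := by
    refine tsum_congr fun k => ?_
    rw [cornerTerm, cornerTerm, bodyNorm_smul, g.symm.norm_map]
  rw [h]

theorem dist_corneredMap_le (hs0 : 0 ≤ s) (hs : s < 1) (V : LE n) :
    dist (corneredMap hs0 hs V) V ≤ 1 - s := by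
  refine dist_LE_le (by linarith) (fun x hx => ⟨s • x, ?_, ?_⟩)
    (fun x hx => ⟨x, mem_corneredBody_of_mem hs.le hx, by simp; linarith⟩)
  · rw [← bodyNorm_le_one_iff, map_smul_eq_mul, Real.norm_of_nonneg hs0]
    exact (mul_le_cornerSeminorm x).trans hx
  · have e : x - s • x = (1 - s) • x := by module
    rw [e, norm_smul, Real.norm_of_nonneg (by linarith)]
    exact mul_le_of_le_one_right (by linarith) (norm_le_of_mem_LE _ hx)

/-- A rounded body has no corners. -/
theorem roundedMap_ne_corneredMap (hs0 : 0 < s) (hs : s < 1) (V W : LE n) :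
    roundedMap hs0 hs.le V ≠ corneredMap hs0.le hs W := by
  intro h
  have hbody : roundedBody s (V : ConvexBody (E n)) = corneredBody s W := congrArg Subtype.val h
  obtain ⟨u, hu0, hu⟩ := exists_contact W
  obtain ⟨v, hv1, hv⟩ := exists_notMem W
  have hlt : ‖v‖ < bodyNorm W v := hv1.trans_lt (not_le.1 (bodyNorm_le_one_iff.not.2 hv))
  -- The common body is a union of balls of radius `1 - s` centred in `s V`, so smoothness would
  -- spread the contact at `u` to `v`.
  refine hlt.ne (norm_eq_of_smooth_cornerSeminorm (s := s) (t := 1 - s)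
    (K := {c | ∃ v ∈ (V : ConvexBody (E n)), s • v = c}) (by linarith) hs0 hs
    (continuous_bodyNorm W) (norm_le_bodyNorm W) (fun x => ?_) hu0 hu)
  rw [← mem_corneredBody, ← hbody, mem_roundedBody hs.le]
  simp

end Maps

end BanachMazur

theorem theorem3p1 (n : ℕ) (δ : ℝ) (hδ : 0 < δ) :
    ∃ f₁ f₂ : C(BanachMazur.LE n, BanachMazur.LE n),
      (∀ (g : BanachMazur.O n) (V : BanachMazur.LE n), f₁ (g • V) = g • f₁ V) ∧
      (∀ (g : BanachMazur.O n) (V : BanachMazur.LE n), f₂ (g • V) = g • f₂ V) ∧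
      BanachMazur.uniformDist f₁ id < ENNReal.ofReal δ ∧
      BanachMazur.uniformDist f₂ id < ENNReal.ofReal δ ∧
      Disjoint (Set.range f₁) (Set.range f₂) := by
  -- The bound `1 - δ / 2` gives `2 (1 - s) < δ`; the bound `1 / 2` only ensures `s > 0`.
  obtain ⟨s, hsmax, hs⟩ := exists_between (max_lt one_half_lt_one (by linarith : 1 - δ / 2 < 1))
  have hs0 : 0 < s := one_half_pos.trans ((le_max_left _ _).trans_lt hsmax)
  have hsδ : 1 - δ / 2 < s := (le_max_right _ _).trans_lt hsmax
  refine ⟨⟨_, BanachMazur.continuous_roundedMap hs0 hs.le⟩,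
    ⟨_, BanachMazur.continuous_corneredMap hs0.le hs⟩,
    BanachMazur.roundedMap_smul hs0 hs.le, BanachMazur.corneredMap_smul hs0.le hs,
    BanachMazur.uniformDist_id_lt (by linarith : 2 * (1 - s) < δ) hδ
      (BanachMazur.dist_roundedMap_le hs0 hs.le),
    BanachMazur.uniformDist_id_lt (by linarith : 1 - s < δ) hδ
      (BanachMazur.dist_corneredMap_le hs0.le hs), ?_⟩
  rw [Set.disjoint_left]
  rintro _ ⟨V, rfl⟩ ⟨W, hW⟩
  exact BanachMazur.roundedMap_ne_corneredMap hs0 hs V W hW.symm
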